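/- **Setting.** A finite-dimensional von Neumann algebra is a finite-dimensional complex unital $*$-algebra $M$ with a submultiplicative norm satisfying the $C^*$-identity $\|a^*a\|=\|a\|^2$ (that is, a finite-dimensional $C^*$-algebra). It is regarded as an operator space by giving each matrix algebra $\mathbb M_n(M)$ its unique $C^*$-norm. For finite-dimensional operator spaces $X,Y$, let $CB(X,Y)$ be the space of linear maps $X\to Y$ with the operator space structure given by the completely bounded norm and $\mathbb M_n(CB(X,Y))\cong CB(X,M_n(Y))$; the dual of $X$ is $X^*=CB(X,\mathbb C)$, and $d\colon X\to X^{**}$ denotes the canonical isomorphism. Write $\mathrm{Ball}(X)$ for the closed unit ball of $X$. For $S\subseteq \mathrm{Ball}(X)$, the polar of $S$ is $$S^\circ=\{f\in \mathrm{Ball}(X^*)\mid f(s)=1 \text{ for all } s\in S\}\subseteq \mathrm{Ball}(X^*),$$ and $S$ is called bipolar if $S=d^{-1}[S^{\circ\circ}]$. The objects of the category $\mathcal Q$ are the pairs $(X,S)$ where $X$ is a finite-dimensional operator space and $S\subseteq\mathrm{Ball}(X)$ is bipolar. **Proposition.** Let $M$ be a finite-dimensional von Neumann algebra and let $u\in M$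 be unitary, i.e. $uu^*=1_M=u^*u$. Then $(M,\{u\})$ is an object of $\mathcal Q$; that is, $\{u\}\subseteq \mathrm{Ball}(M)$ and $\{u\}$ is bipolar in $M$. -/

import Mathlib

namespace OpSpace

/-- The operator norm of a scalar matrix acting on Euclidean space. -/
noncomputable def opNorm {n : ℕ} (α : Matrix (Fin n) (Fin n) ℂ) : ℝ :=
  ‖Matrix.toEuclideanCLM (n := Fin n) (𝕜 := ℂ) α‖

/-- The block diagonal matrix `x ⊕ y`. -/
def directSum {X : Type*} [Zero X] {m n : ℕ} (x : Matrix (Fin m) (Fin m) X)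
    (y : Matrix (Fin n) (Fin n) X) : Matrix (Fin (m + n)) (Fin (m + n)) X :=
  (Matrix.fromBlocks x 0 0 y).submatrix finSumFinEquiv.symm finSumFinEquiv.symm

/-- The product `α x β` of a matrix `x` over a vector space with scalar matrices `α`, `β`. -/
def sandwich {X : Type*} [AddCommGroup X] [Module ℂ X] {n : ℕ} (α : Matrix (Fin n) (Fin n) ℂ)
    (x : Matrix (Fin n) (Fin n) X) (β : Matrix (Fin n) (Fin n) ℂ) : Matrix (Fin n) (Fin n) X :=
  Matrix.of fun i j => ∑ k, ∑ l, (α i k * β l j) • x k l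

/-- An operator space structure on a finite-dimensional complex vector space `X`: a norm on every
matrix space `M_n(X)` satisfying the two axioms of Ruan. (Completeness is automatic in finite
dimension.) -/
structure FdOperatorSpace (X : Type*) [AddCommGroup X] [Module ℂ X] [FiniteDimensional ℂ X] where
  /-- The norm on `M_n(X)`. -/
  matNorm : (n : ℕ) → Matrix (Fin n) (Fin n) X → ℝ
  add_le : ∀ (n : ℕ) (x y : Matrix (Fin n) (Fin n) X),
    matNorm n (x + y) ≤ matNorm n x + matNorm n y
  smul_eq : ∀ (n : ℕ) (c : ℂ) (x : Matrix (Fin n) (Fin n) X),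
    matNorm n (c • x) = ‖c‖ * matNorm n x
  eq_zero : ∀ (n : ℕ) (x : Matrix (Fin n) (Fin n) X), matNorm n x = 0 → x = 0
  directSum_eq : ∀ (m n : ℕ) (x : Matrix (Fin m) (Fin m) X) (y : Matrix (Fin n) (Fin n) X),
    matNorm (m + n) (directSum x y) = max (matNorm m x) (matNorm n y)
  sandwich_le : ∀ (n : ℕ) (α : Matrix (Fin n) (Fin n) ℂ) (x : Matrix (Fin n) (Fin n) X)
    (β : Matrix (Fin n) (Fin n) ℂ),
    matNorm n (sandwich α x β) ≤ opNorm α * matNorm n x * opNorm β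

section scalars

open scoped Matrix.Norms.L2Operator

theorem opNorm_eq {n : ℕ} (α : Matrix (Fin n) (Fin n) ℂ) : opNorm α = ‖α‖ := rfl

theorem opNorm_nonneg {n : ℕ} (α : Matrix (Fin n) (Fin n) ℂ) : 0 ≤ opNorm α := norm_nonneg _

theorem opNorm_le_one {n : ℕ} {α : Matrix (Fin n) (Fin n) ℂ} (h : star α * α = 1) :
    opNorm α ≤ 1 := by
  rw [opNorm_eq]
  have h1 : ‖α‖ * ‖α‖ = ‖(1 : Matrix (Fin n) (Fin n) ℂ)‖ := by
    rw [← h, CStarRing.norm_star_mul_self]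
  have h2 : ‖(1 : Matrix (Fin n) (Fin n) ℂ)‖ ≤ 1 := by
    rw [← Matrix.diagonal_one, Matrix.l2_opNorm_diagonal]
    exact (pi_norm_le_iff_of_nonneg zero_le_one).2 (by simp)
  nlinarith [norm_nonneg α]

theorem directSum_mul {R : Type*} [NonUnitalNonAssocSemiring R] {m n : ℕ}
    (x x' : Matrix (Fin m) (Fin m) R) (y y' : Matrix (Fin n) (Fin n) R) :
    directSum (x * x') (y * y') = directSum x y * directSum x' y' := by
  simp [directSum, Matrix.submatrix_mul_equiv, Matrix.fromBlocks_multiply]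

theorem directSum_conjTranspose {R : Type*} [AddMonoid R] [StarAddMonoid R] {m n : ℕ}
    (x : Matrix (Fin m) (Fin m) R) (y : Matrix (Fin n) (Fin n) R) :
    directSum x.conjTranspose y.conjTranspose = (directSum x y).conjTranspose := by
  simp [directSum, Matrix.fromBlocks_conjTranspose, Matrix.conjTranspose_submatrix]

theorem directSum_add {R : Type*} [AddZeroClass R] {m n : ℕ}
    (x x' : Matrix (Fin m) (Fin m) R) (y y' : Matrix (Fin n) (Fin n) R) :
    directSum (x + x') (y + y') = directSum x y + directSum x' y' := by
  ext i j
  obtain ⟨i, rfl⟩ := finSumFinEquiv.surjective i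
  obtain ⟨j, rfl⟩ := finSumFinEquiv.surjective j
  cases i <;> cases j <;> simp [directSum]

theorem directSum_smul {R : Type*} [AddMonoid R] [DistribMulAction ℂ R] {m n : ℕ} (c : ℂ)
    (x : Matrix (Fin m) (Fin m) R) (y : Matrix (Fin n) (Fin n) R) :
    directSum (c • x) (c • y) = c • directSum x y := by
  ext i j
  obtain ⟨i, rfl⟩ := finSumFinEquiv.surjective i
  obtain ⟨j, rfl⟩ := finSumFinEquiv.surjective j
  cases i <;> cases j <;> simp [directSum]

theorem directSum_zero {R : Type*} [Zero R] {m n : ℕ} :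
    directSum (0 : Matrix (Fin m) (Fin m) R) (0 : Matrix (Fin n) (Fin n) R) = 0 := by
  ext i j
  obtain ⟨i, rfl⟩ := finSumFinEquiv.surjective i
  obtain ⟨j, rfl⟩ := finSumFinEquiv.surjective j
  cases i <;> cases j <;> simp [directSum]

theorem directSum_inj {R : Type*} [Zero R] {m n : ℕ}
    {x x' : Matrix (Fin m) (Fin m) R} {y y' : Matrix (Fin n) (Fin n) R}
    (h : directSum x y = directSum x' y') : x = x' ∧ y = y' := by
  constructor
  · ext i j
    simpa [directSum] using congrFun (congrFun h (Fin.castAdd n i)) (Fin.castAdd n j)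
  · ext i j
    simpa [directSum] using congrFun (congrFun h (Fin.natAdd m i)) (Fin.natAdd m j)

/-- The block diagonal embedding of scalar matrices. -/
def directSumHom (m n : ℕ) :
    (Matrix (Fin m) (Fin m) ℂ × Matrix (Fin n) (Fin n) ℂ) →⋆ₙₐ[ℂ]
      Matrix (Fin (m + n)) (Fin (m + n)) ℂ where
  toFun p := directSum p.1 p.2
  map_smul' c p := directSum_smul c p.1 p.2
  map_zero' := directSum_zero
  map_add' _ _ := directSum_add _ _ _ _
  map_mul' _ _ := directSum_mul _ _ _ _
  map_star' _ := directSum_conjTranspose _ _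

theorem opNorm_directSum {m n : ℕ} (x : Matrix (Fin m) (Fin m) ℂ)
    (y : Matrix (Fin n) (Fin n) ℂ) : opNorm (directSum x y) = max (opNorm x) (opNorm y) :=
  NonUnitalStarAlgHom.norm_map (directSumHom m n)
    (fun _ _ h => Prod.ext (directSum_inj h).1 (directSum_inj h).2) (x, y)

theorem sandwich_eq_mul {n : ℕ} (α x β : Matrix (Fin n) (Fin n) ℂ) :
    sandwich α x β = α * x * β := by
  ext i j
  simp only [sandwich, Matrix.of_apply, Matrix.mul_apply, Finset.sum_mul, smul_eq_mul]
  rw [Finset.sum_comm]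
  exact Finset.sum_congr rfl fun l _ => Finset.sum_congr rfl fun k _ => by ring

/-- The operator space `ℂ`, where `M_n(ℂ)` carries the operator norm. -/
noncomputable def scalarSpace : FdOperatorSpace ℂ where
  matNorm _ x := opNorm x
  add_le _ x y := norm_add_le x y
  smul_eq _ c x := norm_smul c x
  eq_zero _ x h := norm_eq_zero.1 h
  directSum_eq _ _ x y := opNorm_directSum x y
  sandwich_le n α x β := by
    rw [sandwich_eq_mul]
    simp only [opNorm_eq]
    calc ‖α * x * β‖ ≤ ‖α * x‖ * ‖β‖ := norm_mul_le _ _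
      _ ≤ ‖α‖ * ‖x‖ * ‖β‖ := by gcongr; exact norm_mul_le _ _

/-- `α ↦ 1 ⊗ α`, as matrices indexed by `Fin (k * n)`. -/
def ampRight (k : ℕ) {n : ℕ} (α : Matrix (Fin n) (Fin n) ℂ) :
    Matrix (Fin (k * n)) (Fin (k * n)) ℂ :=
  (Matrix.kroneckerMap (· * ·) (1 : Matrix (Fin k) (Fin k) ℂ) α).submatrix
    finProdFinEquiv.symm finProdFinEquiv.symm

/-- `α ↦ α ⊗ 1`, as matrices indexed by `Fin (k * n)`. -/
def ampLeft {k : ℕ} (n : ℕ) (α : Matrix (Fin k) (Fin k) ℂ) :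
    Matrix (Fin (k * n)) (Fin (k * n)) ℂ :=
  (Matrix.kroneckerMap (· * ·) α (1 : Matrix (Fin n) (Fin n) ℂ)).submatrix
    finProdFinEquiv.symm finProdFinEquiv.symm

theorem opNorm_ampRight_le (k : ℕ) {n : ℕ} (α : Matrix (Fin n) (Fin n) ℂ) :
    opNorm (ampRight k α) ≤ opNorm α :=
  NonUnitalStarAlgHom.norm_apply_le
    ({ toFun := ampRight k
       map_smul' := fun c x => by
        ext i j; simp [ampRight, mul_left_comm]
       map_zero' := by ext i j; simp [ampRight]
       map_add' := fun x y => by ext i j; simp [ampRight, mul_add]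
       map_mul' := fun x y => by
        simp only [ampRight, Matrix.submatrix_mul_equiv]
        rw [← Matrix.mul_kronecker_mul, one_mul]
       map_star' := fun x => by
        simp only [ampRight, Matrix.star_eq_conjTranspose, Matrix.conjTranspose_submatrix]
        rw [Matrix.conjTranspose_kronecker, Matrix.conjTranspose_one] } :
      Matrix (Fin n) (Fin n) ℂ →⋆ₙₐ[ℂ] Matrix (Fin (k * n)) (Fin (k * n)) ℂ) α

theorem opNorm_ampLeft_le {k : ℕ} (n : ℕ) (α : Matrix (Fin k) (Fin k) ℂ) :
    opNorm (ampLeft n α) ≤ opNorm α :=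
  NonUnitalStarAlgHom.norm_apply_le
    ({ toFun := ampLeft n
       map_smul' := fun c x => by
        ext i j; simp [ampLeft, mul_assoc]
       map_zero' := by ext i j; simp [ampLeft]
       map_add' := fun x y => by ext i j; simp [ampLeft, add_mul]
       map_mul' := fun x y => by
        simp only [ampLeft, Matrix.submatrix_mul_equiv]
        rw [← Matrix.mul_kronecker_mul, one_mul]
       map_star' := fun x => by
        simp only [ampLeft, Matrix.star_eq_conjTranspose, Matrix.conjTranspose_submatrix]
        rw [Matrix.conjTranspose_kronecker, Matrix.conjTranspose_one] } :
      Matrix (Fin k) (Fin k) ℂ →⋆ₙₐ[ℂ] Matrix (Fin (k * n)) (Fin (k * n)) ℂ) α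

end scalars

section canonical

/-- The norm on `M_n(A)` for a C*-algebra `A`: the unique C*-norm on the *-algebra `M_n(A)`. -/
noncomputable def cstarMatNorm {A : Type*} [CStarAlgebra A] (n : ℕ)
    (x : Matrix (Fin n) (Fin n) A) : ℝ :=
  letI : PartialOrder A := CStarAlgebra.spectralOrder A
  letI : StarOrderedRing A := CStarAlgebra.spectralOrderedRing A
  ‖(CStarMatrix.ofMatrix x : CStarMatrix (Fin n) (Fin n) A)‖

theorem cstarMatNorm_directSum {A : Type*} [CStarAlgebra A] (m n : ℕ)
    (x : Matrix (Fin m) (Fin m) A) (y : Matrix (Fin n) (Fin n) A) :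
    cstarMatNorm (m + n) (directSum x y) = max (cstarMatNorm m x) (cstarMatNorm n y) := by
  let _ : PartialOrder A := CStarAlgebra.spectralOrder A
  let _ : StarOrderedRing A := CStarAlgebra.spectralOrderedRing A
  let φ : (CStarMatrix (Fin m) (Fin m) A × CStarMatrix (Fin n) (Fin n) A) →⋆ₙₐ[ℂ]
      CStarMatrix (Fin (m + n)) (Fin (m + n)) A :=
    { toFun := fun p => directSum (X := A) p.1 p.2
      map_smul' := fun c p => directSum_smul (R := A) c p.1 p.2
      map_zero' := directSum_zero (R := A)
      map_add' := fun p q => directSum_add (R := A) p.1 q.1 p.2 q.2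
      map_mul' := fun p q => directSum_mul (R := A) p.1 q.1 p.2 q.2
      map_star' := fun p => directSum_conjTranspose (R := A) p.1 p.2 }
  have hφ : Function.Injective φ := fun _ _ h =>
    Prod.ext (directSum_inj (R := A) h).1 (directSum_inj (R := A) h).2
  exact NonUnitalStarAlgHom.norm_map φ hφ
    (CStarMatrix.ofMatrix x, CStarMatrix.ofMatrix y)

theorem cstarMatNorm_sandwich_le {A : Type*} [CStarAlgebra A] (n : ℕ)
    (α : Matrix (Fin n) (Fin n) ℂ) (x : Matrix (Fin n) (Fin n) A) (β : Matrix (Fin n) (Fin n) ℂ) :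
    cstarMatNorm n (sandwich α x β) ≤ opNorm α * cstarMatNorm n x * opNorm β := by
  let _ : PartialOrder A := CStarAlgebra.spectralOrder A
  let _ : StarOrderedRing A := CStarAlgebra.spectralOrderedRing A
  let φ : Matrix (Fin n) (Fin n) ℂ →⋆ₙₐ[ℂ] CStarMatrix (Fin n) (Fin n) A :=
    { toFun := fun a => CStarMatrix.ofMatrix (a.map (algebraMap ℂ A))
      map_smul' := fun c p => by ext i j; simp [Algebra.algebraMap_eq_smul_one, mul_smul]
      map_zero' := by ext i j; simp
      map_add' := fun p q => by ext i j; simp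
      map_mul' := fun p q => by
        ext i j; simp [CStarMatrix.mul_apply, Matrix.mul_apply]
      map_star' := fun p => by
        ext i j
        simp [CStarMatrix.star_apply, Algebra.algebraMap_eq_smul_one] }
  have hφ : ∀ a, ‖φ a‖ ≤ opNorm a := by
    open scoped Matrix.Norms.L2Operator in
    exact fun a => NonUnitalStarAlgHom.norm_apply_le φ a
  have h : (CStarMatrix.ofMatrix (sandwich α x β) : CStarMatrix (Fin n) (Fin n) A) =
      φ α * CStarMatrix.ofMatrix x * φ β := by
    ext i j
    simp only [sandwich, CStarMatrix.ofMatrix_apply, Matrix.of_apply, CStarMatrix.mul_apply,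
      Finset.sum_mul]
    rw [Finset.sum_comm]
    refine Finset.sum_congr rfl fun l _ => Finset.sum_congr rfl fun k _ => ?_
    change (α i k * β l j) • x k l = algebraMap ℂ A (α i k) * x k l * algebraMap ℂ A (β l j)
    rw [← Algebra.smul_def, ← Algebra.commutes, ← Algebra.smul_def, smul_smul, mul_comm]
  change ‖(CStarMatrix.ofMatrix (sandwich α x β) : CStarMatrix (Fin n) (Fin n) A)‖ ≤
    opNorm α * ‖(CStarMatrix.ofMatrix x : CStarMatrix (Fin n) (Fin n) A)‖ * opNorm β
  rw [h]
  refine (norm_mul_le _ _).trans (mul_le_mul ((norm_mul_le _ _).trans ?_) (hφ β) (norm_nonneg _)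
    (mul_nonneg (opNorm_nonneg _) (norm_nonneg _)))
  exact mul_le_mul_of_nonneg_right (hφ α) (norm_nonneg _)

/-- The canonical operator space structure of a finite-dimensional C*-algebra (equivalently, of a
finite-dimensional von Neumann algebra). -/
noncomputable def canonical (A : Type*) [CStarAlgebra A] [FiniteDimensional ℂ A] :
    FdOperatorSpace A where
  matNorm n x := cstarMatNorm n x
  add_le n x y := by
    let _ : PartialOrder A := CStarAlgebra.spectralOrder A
    let _ : StarOrderedRing A := CStarAlgebra.spectralOrderedRing A
    exact norm_add_le (CStarMatrix.ofMatrix x : CStarMatrix (Fin n) (Fin n) A)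
      (CStarMatrix.ofMatrix y)
  smul_eq n c x := by
    let _ : PartialOrder A := CStarAlgebra.spectralOrder A
    let _ : StarOrderedRing A := CStarAlgebra.spectralOrderedRing A
    exact norm_smul c (CStarMatrix.ofMatrix x : CStarMatrix (Fin n) (Fin n) A)
  eq_zero n x h := by
    let _ : PartialOrder A := CStarAlgebra.spectralOrder A
    let _ : StarOrderedRing A := CStarAlgebra.spectralOrderedRing A
    exact norm_eq_zero.1 (show ‖(CStarMatrix.ofMatrix x : CStarMatrix (Fin n) (Fin n) A)‖ = 0 from h)
  directSum_eq m n x y := cstarMatNorm_directSum m n x y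
  sandwich_le n α x β := cstarMatNorm_sandwich_le n α x β

end canonical

/-- The identification `M_k(M_n(X)) ≅ M_{kn}(X)`. -/
def flatten {X : Type*} {k n : ℕ} (x : Matrix (Fin k) (Fin k) (Matrix (Fin n) (Fin n) X)) :
    Matrix (Fin (k * n)) (Fin (k * n)) X :=
  Matrix.of fun p q =>
    x (finProdFinEquiv.symm p).1 (finProdFinEquiv.symm q).1
      (finProdFinEquiv.symm p).2 (finProdFinEquiv.symm q).2

theorem flatten_apply {X : Type*} {k n : ℕ} (x : Matrix (Fin k) (Fin k) (Matrix (Fin n) (Fin n) X))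
    (i j : Fin k) (a b : Fin n) :
    flatten x (finProdFinEquiv (i, a)) (finProdFinEquiv (j, b)) = x i j a b := by
  rw [flatten, Matrix.of_apply, Equiv.symm_apply_apply, Equiv.symm_apply_apply]

theorem flatten_directSum {X : Type*} [Zero X] {m k n : ℕ} (x : Matrix (Fin m) (Fin m) (Matrix (Fin n) (Fin n) X))
    (y : Matrix (Fin k) (Fin k) (Matrix (Fin n) (Fin n) X)) :
    ∃ e : Fin ((m + k) * n) ≃ Fin (m * n + k * n),
      flatten (directSum x y) = (directSum (flatten x) (flatten y)).submatrix e e := by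
  refine ⟨finProdFinEquiv.symm.trans ((Equiv.prodCongr finSumFinEquiv.symm (Equiv.refl _)).trans
    ((Equiv.sumProdDistrib _ _ _).trans ((Equiv.sumCongr finProdFinEquiv finProdFinEquiv).trans
      finSumFinEquiv))), ?_⟩
  ext p q
  obtain ⟨⟨i, a⟩, rfl⟩ := finProdFinEquiv.surjective p
  obtain ⟨⟨j, b⟩, rfl⟩ := finProdFinEquiv.surjective q
  obtain ⟨i, rfl⟩ := finSumFinEquiv.surjective i
  obtain ⟨j, rfl⟩ := finSumFinEquiv.surjective j
  cases i <;> cases j <;>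
    simp [flatten_apply, directSum, Equiv.sumProdDistrib, -finSumFinEquiv_apply_left,
      -finSumFinEquiv_apply_right, -finProdFinEquiv_symm_apply, -finProdFinEquiv_apply_val]

theorem flatten_sandwich {X : Type*} [AddCommGroup X] [Module ℂ X] {k n : ℕ} (α : Matrix (Fin k) (Fin k) ℂ)
    (x : Matrix (Fin k) (Fin k) (Matrix (Fin n) (Fin n) X)) (β : Matrix (Fin k) (Fin k) ℂ) :
    flatten (sandwich α x β) = sandwich (ampLeft n α) (flatten x) (ampLeft n β) := by
  ext p q
  obtain ⟨⟨i, a⟩, rfl⟩ := finProdFinEquiv.surjective p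
  obtain ⟨⟨j, b⟩, rfl⟩ := finProdFinEquiv.surjective q
  simp only [flatten_apply, sandwich, Matrix.of_apply, Matrix.sum_apply, Matrix.smul_apply]
  rw [← finProdFinEquiv.sum_comp, Fintype.sum_prod_type]
  refine Finset.sum_congr rfl fun u _ => ?_
  rw [Finset.sum_eq_single a]
  · rw [← finProdFinEquiv.sum_comp, Fintype.sum_prod_type]
    refine Finset.sum_congr rfl fun v _ => ?_
    rw [Finset.sum_eq_single b]
    · simp [flatten_apply, ampLeft, -finProdFinEquiv_symm_apply]
    · intro c _ hc
      simp [flatten_apply, ampLeft, -finProdFinEquiv_symm_apply, hc]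
    · simp
  · intro c _ hc
    simp [ampLeft, -finProdFinEquiv_symm_apply, Ne.symm hc]
  · simp

theorem flatten_injective {X : Type*} {k n : ℕ} :
    Function.Injective (flatten : Matrix (Fin k) (Fin k) (Matrix (Fin n) (Fin n) X) → _) := by
  intro x y h
  ext i j a b
  simpa only [flatten_apply] using congrFun (congrFun h (finProdFinEquiv (i, a))) (finProdFinEquiv (j, b))

/-- A matrix of linear maps `[F_ij]`, viewed as the linear map `x ↦ [F_ij x]`; this is the
identification `M_n(CB(X, Y)) ≅ CB(X, M_n(Y))`. -/
def matrixMap {X Y : Type*} [AddCommGroup X] [Module ℂ X]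
    [AddCommGroup Y] [Module ℂ Y] {n : ℕ} (F : Matrix (Fin n) (Fin n) (X →ₗ[ℂ] Y)) :
    X →ₗ[ℂ] Matrix (Fin n) (Fin n) Y where
  toFun x := Matrix.of fun i j => F i j x
  map_add' x y := by ext i j; simp
  map_smul' c x := by ext i j; simp

theorem flatten_matrixMap_sandwich {X Y : Type*} [AddCommGroup X] [Module ℂ X]
    [AddCommGroup Y] [Module ℂ Y] {n k : ℕ} (α : Matrix (Fin n) (Fin n) ℂ)
    (F : Matrix (Fin n) (Fin n) (X →ₗ[ℂ] Y)) (β : Matrix (Fin n) (Fin n) ℂ)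
    (x : Matrix (Fin k) (Fin k) X) :
    flatten (x.map (matrixMap (sandwich α F β))) =
      sandwich (ampRight k α) (flatten (x.map (matrixMap F))) (ampRight k β) := by
  ext p q
  obtain ⟨⟨i, a⟩, rfl⟩ := finProdFinEquiv.surjective p
  obtain ⟨⟨j, b⟩, rfl⟩ := finProdFinEquiv.surjective q
  simp only [flatten_apply, sandwich, Matrix.of_apply, Matrix.map_apply, matrixMap,
    LinearMap.coe_mk, AddHom.coe_mk, LinearMap.sum_apply, LinearMap.smul_apply]
  rw [← finProdFinEquiv.sum_comp, Fintype.sum_prod_type, Finset.sum_eq_single i]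
  · refine Finset.sum_congr rfl fun u _ => ?_
    rw [← finProdFinEquiv.sum_comp, Fintype.sum_prod_type, Finset.sum_eq_single j]
    · refine Finset.sum_congr rfl fun v _ => ?_
      simp [flatten_apply, ampRight, -finProdFinEquiv_symm_apply]
    · intro c _ hc
      simp [ampRight, -finProdFinEquiv_symm_apply, hc]
    · simp
  · intro c _ hc
    simp [ampRight, -finProdFinEquiv_symm_apply, Ne.symm hc]
  · simp

theorem flatten_matrixMap_directSum {X Y : Type*} [AddCommGroup X] [Module ℂ X]
    [AddCommGroup Y] [Module ℂ Y] {m n k : ℕ} (F : Matrix (Fin m) (Fin m) (X →ₗ[ℂ] Y))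
    (G : Matrix (Fin n) (Fin n) (X →ₗ[ℂ] Y)) :
    ∃ e : Fin (k * (m + n)) ≃ Fin (k * m + k * n), ∀ x : Matrix (Fin k) (Fin k) X,
      flatten (x.map (matrixMap (directSum F G))) =
        (directSum (flatten (x.map (matrixMap F)))
          (flatten (x.map (matrixMap G)))).submatrix e e := by
  refine ⟨finProdFinEquiv.symm.trans ((Equiv.prodCongr (Equiv.refl _) finSumFinEquiv.symm).trans
    ((Equiv.prodSumDistrib _ _ _).trans ((Equiv.sumCongr finProdFinEquiv finProdFinEquiv).trans
      finSumFinEquiv))), fun x => ?_⟩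
  ext p q
  obtain ⟨⟨i, a⟩, rfl⟩ := finProdFinEquiv.surjective p
  obtain ⟨⟨j, b⟩, rfl⟩ := finProdFinEquiv.surjective q
  obtain ⟨a, rfl⟩ := finSumFinEquiv.surjective a
  obtain ⟨b, rfl⟩ := finSumFinEquiv.surjective b
  cases a <;> cases b <;>
    simp [flatten_apply, directSum, matrixMap, Equiv.prodSumDistrib, Equiv.sumProdDistrib,
      -finSumFinEquiv_apply_left, -finSumFinEquiv_apply_right, -finProdFinEquiv_symm_apply,
      -finProdFinEquiv_apply_val]

namespace FdOperatorSpace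

variable {X : Type*} [AddCommGroup X] [Module ℂ X] [FiniteDimensional ℂ X]
variable {Y : Type*} [AddCommGroup Y] [Module ℂ Y] [FiniteDimensional ℂ Y]

theorem matNorm_zero (S : FdOperatorSpace X) (n : ℕ) : S.matNorm n 0 = 0 := by
  simpa using S.smul_eq n 0 0

theorem matNorm_nonneg (S : FdOperatorSpace X) (n : ℕ) (x : Matrix (Fin n) (Fin n) X) :
    0 ≤ S.matNorm n x := by
  have h := S.add_le n x ((-1 : ℂ) • x)
  rw [S.smul_eq, neg_one_smul, add_neg_cancel, S.matNorm_zero] at h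
  simp at h
  linarith

theorem matNorm_sum_le (S : FdOperatorSpace X) (n : ℕ) {ι : Type*} (s : Finset ι)
    (f : ι → Matrix (Fin n) (Fin n) X) :
    S.matNorm n (∑ i ∈ s, f i) ≤ ∑ i ∈ s, S.matNorm n (f i) := by
  classical
  induction s using Finset.induction_on with
  | empty => simp [S.matNorm_zero]
  | insert a s ha ih =>
    rw [Finset.sum_insert ha, Finset.sum_insert ha]
    exact (S.add_le _ _ _).trans (by linarith)

theorem matNorm_submatrix_le (S : FdOperatorSpace X) {n m : ℕ} (e : Fin m ≃ Fin n)
    (x : Matrix (Fin n) (Fin n) X) : S.matNorm m (x.submatrix e e) ≤ S.matNorm n x := by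
  obtain rfl : m = n := by simpa using Fintype.card_congr e
  let P : Matrix (Fin m) (Fin m) ℂ := Matrix.of fun i k => if e i = k then 1 else 0
  have h : x.submatrix e e = sandwich P x P.conjTranspose := by
    ext i j
    simp only [sandwich, Matrix.of_apply, Matrix.submatrix_apply]
    rw [Finset.sum_eq_single (e i), Finset.sum_eq_single (e j)]
    · simp [P]
    · intro b _ hb
      simp [P, Ne.symm hb]
    · simp
    · intro b _ hb
      simp [P, Ne.symm hb]
    · simp
  have hP : P * star P = 1 := by
    ext i j
    simp [P, Matrix.mul_apply, Matrix.star_apply, Matrix.one_apply, eq_comm]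
  have hP' : star P * P = 1 := mul_eq_one_comm.1 hP
  have h1 : opNorm P ≤ 1 := opNorm_le_one hP'
  have h2 : opNorm P.conjTranspose ≤ 1 := opNorm_le_one (by
    rw [← Matrix.star_eq_conjTranspose, star_star, hP])
  rw [h]
  refine (S.sandwich_le _ _ _ _).trans ?_
  have := S.matNorm_nonneg m x
  calc _ ≤ 1 * S.matNorm m x * 1 := by
        gcongr
        exact opNorm_nonneg _
    _ = _ := by ring

theorem matNorm_submatrix (S : FdOperatorSpace X) {n m : ℕ} (e : Fin m ≃ Fin n)
    (x : Matrix (Fin n) (Fin n) X) : S.matNorm m (x.submatrix e e) = S.matNorm n x := by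
  refine le_antisymm (S.matNorm_submatrix_le e x) ?_
  simpa using S.matNorm_submatrix_le e.symm (x.submatrix e e)

/-- The canonical operator space structure on `M_n(X)`. -/
noncomputable def matrixSpace (S : FdOperatorSpace X) (n : ℕ) :
    FdOperatorSpace (Matrix (Fin n) (Fin n) X) where
  matNorm k x := S.matNorm (k * n) (flatten x)
  add_le k x y := S.add_le _ (flatten x) (flatten y)
  smul_eq k c x := S.smul_eq _ c (flatten x)
  eq_zero k x h := flatten_injective (S.eq_zero _ _ h)
  directSum_eq m k x y := by
    obtain ⟨e, he⟩ := flatten_directSum x y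
    rw [he, S.matNorm_submatrix, S.directSum_eq]
  sandwich_le k α x β := by
    rw [flatten_sandwich]
    refine (S.sandwich_le _ _ _ _).trans ?_
    have := S.matNorm_nonneg _ (flatten x)
    have h1 := opNorm_nonneg α
    gcongr
    · exact opNorm_nonneg _
    · exact opNorm_ampLeft_le n α
    · exact opNorm_ampLeft_le n β

/-- The operator norm of the `n`-th amplification `φ_n : M_n(X) → M_n(Y)`. -/
noncomputable def ampNorm (S : FdOperatorSpace X) (T : FdOperatorSpace Y) (φ : X →ₗ[ℂ] Y)
    (n : ℕ) : ℝ :=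
  sSup {r : ℝ | ∃ x : Matrix (Fin n) (Fin n) X, S.matNorm n x ≤ 1 ∧ r = T.matNorm n (x.map φ)}

/-- The completely bounded norm `‖φ‖_cb = sup_n ‖φ_n‖`; the supremum is finite because `X` is
finite-dimensional, see `exists_cb_bound`. -/
noncomputable def cbNorm (S : FdOperatorSpace X) (T : FdOperatorSpace Y) (φ : X →ₗ[ℂ] Y) : ℝ :=
  ⨆ n : ℕ, S.ampNorm T φ n

/-- The norm of `x : X`, under `X ≅ M_1(X)`. -/
noncomputable def groundNorm (S : FdOperatorSpace X) (x : X) : ℝ :=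
  S.matNorm 1 (Matrix.of fun _ _ => x)

theorem exists_functional_bound (S : FdOperatorSpace X) (f : X →ₗ[ℂ] ℂ) :
    ∃ C : ℝ, 0 ≤ C ∧ ∀ x, ‖f x‖ ≤ C * S.groundNorm x := by
  let i0 : Norm X := ⟨S.groundNorm⟩
  let core : NormedSpace.Core ℂ X :=
    { norm_nonneg := fun x => S.matNorm_nonneg _ _
      norm_smul := fun c x => S.smul_eq _ c _
      norm_triangle := fun x y => S.add_le _ _ _
      norm_eq_zero_iff := fun x =>
        ⟨fun h => congrFun (congrFun (S.eq_zero _ _ h) 0) 0, fun h => by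
          subst h
          exact S.matNorm_zero 1⟩ }
  let i1 : NormedAddCommGroup X := NormedAddCommGroup.ofCore core
  let i2 : NormedSpace ℂ X := NormedSpace.ofCore core
  exact ⟨‖LinearMap.toContinuousLinearMap f‖, norm_nonneg _,
    fun x => (LinearMap.toContinuousLinearMap f).le_opNorm x⟩

theorem groundNorm_combo_le (S : FdOperatorSpace X) {n : ℕ} (x : Matrix (Fin n) (Fin n) X)
    (a b : EuclideanSpace ℂ (Fin n)) :
    S.groundNorm (∑ i, ∑ j, (star (a i) * b j) • x i j) ≤ ‖a‖ * S.matNorm n x * ‖b‖ := by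
  obtain rfl | ⟨k, rfl⟩ : n = 0 ∨ ∃ k, n = 1 + k := by
    cases n with
    | zero => exact Or.inl rfl
    | succ k => exact Or.inr ⟨k, Nat.add_comm _ _⟩
  · have h := S.matNorm_zero 1
    have h0 := mul_nonneg (mul_nonneg (norm_nonneg a) (S.matNorm_nonneg 0 x)) (norm_nonneg b)
    refine le_trans (le_of_eq ?_) h0
    simp only [Finset.univ_eq_empty, Finset.sum_empty]
    exact h
  · let z : Fin (1 + k) := Fin.castAdd k 0
    let α : Matrix (Fin (1 + k)) (Fin (1 + k)) ℂ :=
      Matrix.of fun i l => if i = z then star (a l) else 0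
    let β : Matrix (Fin (1 + k)) (Fin (1 + k)) ℂ :=
      Matrix.of fun l j => if j = z then b l else 0
    set w := ∑ i, ∑ j, (star (a i) * b j) • x i j with hw
    have hs : sandwich α x β =
        directSum (Matrix.of fun _ _ => w : Matrix (Fin 1) (Fin 1) X)
          (0 : Matrix (Fin k) (Fin k) X) := by
      ext i j
      obtain ⟨i, rfl⟩ := finSumFinEquiv.surjective i
      obtain ⟨j, rfl⟩ := finSumFinEquiv.surjective j
      have hz : z = finSumFinEquiv (Sum.inl 0) := rfl
      cases i <;> cases j <;>
        simp [sandwich, directSum, α, β, hz, hw, -finSumFinEquiv_apply_left,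
          -finSumFinEquiv_apply_right, Subsingleton.elim _ (0 : Fin 1)]
    have h1 := S.sandwich_le _ α x β
    rw [hs, S.directSum_eq, S.matNorm_zero, max_eq_left (S.matNorm_nonneg _ _)] at h1
    have hα : opNorm α ≤ ‖a‖ := by
      refine ContinuousLinearMap.opNorm_le_bound _ (norm_nonneg _) fun v => ?_
      have : Matrix.toEuclideanCLM (n := Fin (1 + k)) (𝕜 := ℂ) α v =
          EuclideanSpace.single z (inner ℂ a v) := by
        ext i
        rw [Matrix.ofLp_toEuclideanCLM]
        by_cases hi : i = z
        · simp [Matrix.mulVec, dotProduct, α, hi, PiLp.inner_apply, mul_comm]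
        · simp [Matrix.mulVec, dotProduct, α, hi]
      rw [this, PiLp.norm_single]
      exact norm_inner_le_norm _ _
    have hβ : opNorm β ≤ ‖b‖ := by
      refine ContinuousLinearMap.opNorm_le_bound _ (norm_nonneg _) fun v => ?_
      have : Matrix.toEuclideanCLM (n := Fin (1 + k)) (𝕜 := ℂ) β v = (v z) • b := by
        ext i
        rw [Matrix.ofLp_toEuclideanCLM]
        simp [Matrix.mulVec, dotProduct, β, mul_comm]
      rw [this, norm_smul, mul_comm]
      gcongr
      exact PiLp.norm_apply_le v z
    refine h1.trans ?_
    have := S.matNorm_nonneg _ x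
    gcongr
    exact opNorm_nonneg _

theorem exists_functional_cb_bound (S : FdOperatorSpace X) (f : X →ₗ[ℂ] ℂ) :
    ∃ C : ℝ, 0 ≤ C ∧ ∀ n (x : Matrix (Fin n) (Fin n) X), opNorm (x.map f) ≤ C * S.matNorm n x := by
  obtain ⟨C, hC, h⟩ := S.exists_functional_bound f
  refine ⟨C, hC, fun n x => ?_⟩
  have hx := S.matNorm_nonneg n x
  refine ContinuousLinearMap.opNorm_le_bound _ (mul_nonneg hC hx) fun v => ?_
  set w := Matrix.toEuclideanCLM (n := Fin n) (𝕜 := ℂ) (x.map f) v with hw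
  have h1 : inner ℂ w w = f (∑ i, ∑ j, (star (w i) * v j) • x i j) := by
    nth_rw 2 [hw]
    simp only [PiLp.inner_apply, map_sum, map_smul, Matrix.ofLp_toEuclideanCLM]
    refine Finset.sum_congr rfl fun i _ => ?_
    simp only [Matrix.mulVec, dotProduct, RCLike.inner_apply, Matrix.map_apply, Finset.sum_mul,
      smul_eq_mul]
    refine Finset.sum_congr rfl fun j _ => ?_
    simp
    ring
  have h2 : ‖w‖ * ‖w‖ ≤ (C * S.matNorm n x * ‖v‖) * ‖w‖ := by
    have h3 : ‖w‖ * ‖w‖ = ‖(inner ℂ w w : ℂ)‖ := by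
      rw [inner_self_eq_norm_sq_to_K]
      simp [sq]
    rw [h3, h1]
    refine (h _).trans ?_
    have := mul_le_mul_of_nonneg_left (S.groundNorm_combo_le x w v) hC
    linarith
  rcases (norm_nonneg w).eq_or_lt with h0 | h0
  · rw [← h0]
    exact mul_nonneg (mul_nonneg hC hx) (norm_nonneg _)
  · exact le_of_mul_le_mul_right h2 h0

theorem matNorm_diagonal_le (S : FdOperatorSpace X) (y : X) (n : ℕ) :
    S.matNorm n (Matrix.diagonal fun _ => y) ≤ S.groundNorm y := by
  induction n with
  | zero =>
    rw [Subsingleton.elim (Matrix.diagonal fun _ => y) 0, S.matNorm_zero]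
    exact S.matNorm_nonneg _ _
  | succ n ih =>
    have : (Matrix.diagonal fun _ => y : Matrix (Fin (n + 1)) (Fin (n + 1)) X) =
        directSum (Matrix.diagonal fun _ => y : Matrix (Fin n) (Fin n) X)
          (Matrix.of fun _ _ => y : Matrix (Fin 1) (Fin 1) X) := by
      ext i j
      obtain ⟨i, rfl⟩ := finSumFinEquiv.surjective i
      obtain ⟨j, rfl⟩ := finSumFinEquiv.surjective j
      cases i <;> cases j <;>
        simp [directSum, Matrix.diagonal_apply, -finSumFinEquiv_apply_left,
          -finSumFinEquiv_apply_right, eq_iff_true_of_subsingleton]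
    rw [this, S.directSum_eq]
    exact max_le ih le_rfl

theorem exists_cb_bound (S : FdOperatorSpace X) (T : FdOperatorSpace Y) (φ : X →ₗ[ℂ] Y) :
    ∃ C : ℝ, 0 ≤ C ∧
      ∀ n (x : Matrix (Fin n) (Fin n) X), T.matNorm n (x.map φ) ≤ C * S.matNorm n x := by
  let b := Module.finBasis ℂ X
  choose C hC h using fun t => S.exists_functional_cb_bound (b.coord t)
  refine ⟨∑ t, C t * T.groundNorm (φ (b t)),
    Finset.sum_nonneg fun t _ => mul_nonneg (hC t) (T.matNorm_nonneg _ _), fun n x => ?_⟩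
  have hx : x.map φ = ∑ t, sandwich (x.map (b.coord t)) (Matrix.diagonal fun _ => φ (b t)) 1 := by
    ext i j
    rw [Matrix.sum_apply, Matrix.map_apply]
    conv_lhs => rw [← b.sum_repr (x i j), map_sum]
    refine Finset.sum_congr rfl fun t _ => ?_
    simp [sandwich, Matrix.diagonal_apply, Matrix.one_apply]
  rw [hx, Finset.sum_mul]
  refine (T.matNorm_sum_le _ _ _).trans (Finset.sum_le_sum fun t _ => ?_)
  refine (T.sandwich_le _ _ _ _).trans ?_
  have h1 : opNorm (1 : Matrix (Fin n) (Fin n) ℂ) ≤ 1 := opNorm_le_one (by simp)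
  have h2 := T.matNorm_diagonal_le (φ (b t)) n
  have h3 := T.matNorm_nonneg n (Matrix.diagonal fun _ => φ (b t))
  have h4 := S.matNorm_nonneg n x
  have h5 := h t n x
  have h6 := opNorm_nonneg (x.map (b.coord t))
  calc _ ≤ (C t * S.matNorm n x) * T.groundNorm (φ (b t)) * 1 := by
        gcongr
        · exact opNorm_nonneg _
        · exact mul_nonneg (mul_nonneg (hC t) h4) (T.matNorm_nonneg _ _)
        · exact mul_nonneg (hC t) h4
    _ = _ := by ring

theorem ampNorm_bdd (S : FdOperatorSpace X) (T : FdOperatorSpace Y) {φ : X →ₗ[ℂ] Y} {C : ℝ}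
    (hC : 0 ≤ C) {n : ℕ}
    (h : ∀ x : Matrix (Fin n) (Fin n) X, T.matNorm n (x.map φ) ≤ C * S.matNorm n x) :
    C ∈ upperBounds {r : ℝ | ∃ x : Matrix (Fin n) (Fin n) X,
      S.matNorm n x ≤ 1 ∧ r = T.matNorm n (x.map φ)} := by
  rintro r ⟨x, hx, rfl⟩
  exact (h x).trans (mul_le_of_le_one_right hC hx)

theorem ampNorm_nonneg (S : FdOperatorSpace X) (T : FdOperatorSpace Y) (φ : X →ₗ[ℂ] Y) (n : ℕ) :
    0 ≤ S.ampNorm T φ n :=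
  Real.sSup_nonneg (by rintro r ⟨x, -, rfl⟩; exact T.matNorm_nonneg _ _)

theorem cbNorm_nonneg (S : FdOperatorSpace X) (T : FdOperatorSpace Y) (φ : X →ₗ[ℂ] Y) :
    0 ≤ S.cbNorm T φ :=
  Real.iSup_nonneg fun n => S.ampNorm_nonneg T φ n

theorem cbNorm_le (S : FdOperatorSpace X) (T : FdOperatorSpace Y) {φ : X →ₗ[ℂ] Y} {C : ℝ}
    (hC : 0 ≤ C)
    (h : ∀ n (x : Matrix (Fin n) (Fin n) X), T.matNorm n (x.map φ) ≤ C * S.matNorm n x) :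
    S.cbNorm T φ ≤ C :=
  Real.iSup_le (fun n => Real.sSup_le (S.ampNorm_bdd T hC (h n)) hC) hC

theorem matNorm_map_le (S : FdOperatorSpace X) (T : FdOperatorSpace Y) (φ : X →ₗ[ℂ] Y) (n : ℕ)
    (x : Matrix (Fin n) (Fin n) X) : T.matNorm n (x.map φ) ≤ S.cbNorm T φ * S.matNorm n x := by
  obtain ⟨C, hC, h⟩ := S.exists_cb_bound T φ
  have key : ∀ y : Matrix (Fin n) (Fin n) X, S.matNorm n y ≤ 1 →
      T.matNorm n (y.map φ) ≤ S.cbNorm T φ := fun y hy =>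
    le_trans (le_csSup ⟨C, S.ampNorm_bdd T hC (h n)⟩ ⟨y, hy, rfl⟩)
      (le_ciSup (f := fun n => S.ampNorm T φ n)
        ⟨C, by rintro r ⟨m, rfl⟩; exact Real.sSup_le (S.ampNorm_bdd T hC (h m)) hC⟩ n)
  rcases (S.matNorm_nonneg n x).eq_or_lt with h0 | h0
  · simpa [← h0] using h n x
  · have h1 := key (((S.matNorm n x)⁻¹ : ℂ) • x) (by
      rw [S.smul_eq, norm_inv, Complex.norm_real, Real.norm_of_nonneg h0.le,
        inv_mul_cancel₀ h0.ne'])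
    have h2 : (((S.matNorm n x)⁻¹ : ℂ) • x).map φ = ((S.matNorm n x)⁻¹ : ℂ) • x.map φ := by
      ext i j; simp
    rw [h2, T.smul_eq, norm_inv, Complex.norm_real, Real.norm_of_nonneg h0.le,
      inv_mul_le_iff₀ h0] at h1
    linarith

/-- The operator space `CB(X, Y)`: the norm of `[F_ij] ∈ M_n(CB(X, Y))` is the completely bounded
norm of the corresponding map `X → M_n(Y)`. (Every linear map is completely bounded here.) -/
noncomputable def CB (S : FdOperatorSpace X) (T : FdOperatorSpace Y) :
    FdOperatorSpace (X →ₗ[ℂ] Y) where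
  matNorm n F := S.cbNorm (T.matrixSpace n) (matrixMap F)
  add_le n F G := by
    refine S.cbNorm_le _ (add_nonneg (S.cbNorm_nonneg _ _) (S.cbNorm_nonneg _ _)) fun k x => ?_
    have h : x.map (matrixMap (F + G)) = x.map (matrixMap F) + x.map (matrixMap G) := by
      ext i j a b; simp [matrixMap]
    rw [h, add_mul]
    exact ((T.matrixSpace n).add_le _ _ _).trans
      (add_le_add (S.matNorm_map_le _ _ _ _) (S.matNorm_map_le _ _ _ _))
  smul_eq n c F := by
    have key : ∀ (c : ℂ) (F : Matrix (Fin n) (Fin n) (X →ₗ[ℂ] Y)),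
        S.cbNorm (T.matrixSpace n) (matrixMap (c • F)) ≤
          ‖c‖ * S.cbNorm (T.matrixSpace n) (matrixMap F) := fun c F => by
      refine S.cbNorm_le _ (mul_nonneg (norm_nonneg _) (S.cbNorm_nonneg _ _)) fun k x => ?_
      have h : x.map (matrixMap (c • F)) = c • x.map (matrixMap F) := by
        ext i j a b; simp [matrixMap]
      rw [h, (T.matrixSpace n).smul_eq, mul_assoc]
      exact mul_le_mul_of_nonneg_left (S.matNorm_map_le _ _ _ _) (norm_nonneg _)
    refine le_antisymm (key c F) ?_
    rcases eq_or_ne c 0 with rfl | hc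
    · simpa using S.cbNorm_nonneg _ _
    · have h := key c⁻¹ (c • F)
      rw [inv_smul_smul₀ hc, norm_inv] at h
      rwa [← le_inv_mul_iff₀ (norm_pos_iff.2 hc)]
  eq_zero n F hF := by
    ext i j x
    have h := S.matNorm_map_le (T.matrixSpace n) (matrixMap F) 1 (Matrix.of fun _ _ => x)
    rw [hF, zero_mul] at h
    have h' := (T.matrixSpace n).eq_zero _ _ (le_antisymm h ((T.matrixSpace n).matNorm_nonneg _ _))
    simpa [matrixMap] using congrFun (congrFun (congrFun (congrFun h' 0) 0) i) j
  directSum_eq m n F G := by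
    have key : ∀ (k : ℕ) (x : Matrix (Fin k) (Fin k) X),
        (T.matrixSpace (m + n)).matNorm k (x.map (matrixMap (directSum F G))) =
          max ((T.matrixSpace m).matNorm k (x.map (matrixMap F)))
            ((T.matrixSpace n).matNorm k (x.map (matrixMap G))) := fun k x => by
      obtain ⟨e, he⟩ := flatten_matrixMap_directSum (k := k) F G
      change T.matNorm _ (flatten _) = max (T.matNorm _ (flatten _)) (T.matNorm _ (flatten _))
      rw [he, T.matNorm_submatrix, T.directSum_eq]
    apply le_antisymm
    · refine S.cbNorm_le _ (le_max_of_le_left (S.cbNorm_nonneg _ _)) fun k x => ?_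
      have hx := S.matNorm_nonneg k x
      rw [key, max_mul_of_nonneg _ _ hx]
      exact max_le_max (S.matNorm_map_le _ _ _ _) (S.matNorm_map_le _ _ _ _)
    · refine max_le ?_ ?_ <;> refine S.cbNorm_le _ (S.cbNorm_nonneg _ _) fun k x => ?_
      · exact (le_max_left _ _).trans ((key k x).symm.le.trans (S.matNorm_map_le _ _ _ _))
      · exact (le_max_right _ _).trans ((key k x).symm.le.trans (S.matNorm_map_le _ _ _ _))
  sandwich_le n α F β := by
    have h0 := S.cbNorm_nonneg (T.matrixSpace n) (matrixMap F)
    have h1 := opNorm_nonneg α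
    have h2 := opNorm_nonneg β
    refine S.cbNorm_le _ (by positivity) fun k x => ?_
    change T.matNorm _ (flatten _) ≤ _
    rw [flatten_matrixMap_sandwich]
    refine (T.sandwich_le _ _ _ _).trans ?_
    have h3 := S.matNorm_map_le (T.matrixSpace n) (matrixMap F) k x
    change T.matNorm _ (flatten _) ≤ _ at h3
    have h4 := T.matNorm_nonneg _ (flatten (x.map (matrixMap F)))
    have h5 := S.matNorm_nonneg k x
    calc _ ≤ opNorm α * (S.cbNorm (T.matrixSpace n) (matrixMap F) * S.matNorm k x) * opNorm β := by
          gcongr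
          · exact opNorm_nonneg _
          · exact opNorm_ampRight_le k α
          · exact opNorm_ampRight_le k β
      _ = _ := by ring

/-- The dual operator space `X* = CB(X, ℂ)`. -/
noncomputable def dual (S : FdOperatorSpace X) : FdOperatorSpace (Module.Dual ℂ X) :=
  S.CB scalarSpace

/-- The closed unit ball of an operator space. -/
def ball (S : FdOperatorSpace X) : Set X := {x | S.groundNorm x ≤ 1}

/-- The polar `A° = {f ∈ Ball(X*) | ∀ s ∈ A, f(s) = 1}`. -/
def polar (S : FdOperatorSpace X) (A : Set X) : Set (Module.Dual ℂ X) :=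
  {f | f ∈ S.dual.ball ∧ ∀ s ∈ A, f s = 1}

/-- `A` is bipolar if `A = d⁻¹[A°°]`, where `d : X → X**` is the canonical map. -/
def IsBipolar (S : FdOperatorSpace X) (A : Set X) : Prop :=
  A = Module.Dual.eval ℂ X ⁻¹' S.dual.polar (S.polar A)

/-- `(X, A)` is an object of the category `Q`: `A` is a bipolar subset of the unit ball of the
finite-dimensional operator space `X`. -/
structure IsQObject (S : FdOperatorSpace X) (A : Set X) : Prop where
  subset_ball : A ⊆ S.ball
  isBipolar : S.IsBipolar A

end FdOperatorSpace

end OpSpace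

/-! Every point of a set `A` in the ball lies in its bipolar, because evaluation `X → X**` is
contractive. The content is the converse: `u` must be the only `x` with `f x = 1` for all `f` in the
polar of `{u}`.

Multiplication by `star u` is contractive and sends `u` to `1`. So for every state `φ` (a functional
with `‖φ‖ ≤ 1` and `φ 1 = 1`) the functional `x ↦ φ (star u * x)` is contractive and takes the value
`1` at `u`. It lies in the polar because a contractive functional is completely contractive
(`opNorm_map_functional_le`). If `x` is in the bipolar, every state therefore vanishes on `star u *
x - 1`. States separate points (`eq_zero_of_forall_state`), so `star u * x = 1`, and multiplying by
`u` gives `x = u`.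

Separation comes from Hahn–Banach: a functional norming `‖a‖ • 1 + a` is forced to be a state that
does not kill the self-adjoint `a`. General elements reduce to self-adjoint ones because states are
real on those. -/

namespace OpSpace

/-! ### Functionals on an operator space, evaluation and bipolars -/

namespace FdOperatorSpace

variable {X : Type*} [AddCommGroup X] [Module ℂ X] [FiniteDimensional ℂ X]

/-- A functional that is bounded by `C` on `X` is completely bounded by `C`. -/
theorem opNorm_map_functional_le (S : FdOperatorSpace X) {f : X →ₗ[ℂ] ℂ} {C : ℝ} (hC : 0 ≤ C)
    (h : ∀ x, ‖f x‖ ≤ C * S.groundNorm x) (n : ℕ) (x : Matrix (Fin n) (Fin n) X) :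
    opNorm (x.map f) ≤ C * S.matNorm n x := by
  have hx := S.matNorm_nonneg n x
  refine ContinuousLinearMap.opNorm_le_bound _ (mul_nonneg hC hx) fun v => ?_
  set w := Matrix.toEuclideanCLM (n := Fin n) (𝕜 := ℂ) (x.map f) v with hw
  -- Pairing `w = f_n(x) v` with itself pulls `f` outside the sum, leaving its value at the single
  -- element `w* x v` of `X`. By Ruan's axioms that element has norm at most `‖w‖ ‖x‖ ‖v‖`, so the
  -- constant of `f` survives amplification unchanged.
  have h1 : inner ℂ w w = f (∑ i, ∑ j, (star (w i) * v j) • x i j) := by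
    nth_rw 2 [hw]
    simp only [PiLp.inner_apply, map_sum, map_smul, Matrix.ofLp_toEuclideanCLM]
    refine Finset.sum_congr rfl fun i _ => ?_
    simp only [Matrix.mulVec, dotProduct, RCLike.inner_apply, Matrix.map_apply, Finset.sum_mul,
      smul_eq_mul]
    refine Finset.sum_congr rfl fun j _ => ?_
    simp
    ring
  have h2 : ‖w‖ * ‖w‖ ≤ (C * S.matNorm n x * ‖v‖) * ‖w‖ := by
    have h3 : ‖w‖ * ‖w‖ = ‖(inner ℂ w w : ℂ)‖ := by
      rw [inner_self_eq_norm_sq_to_K]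
      simp [sq]
    rw [h3, h1]
    refine (h _).trans ?_
    have := mul_le_mul_of_nonneg_left (S.groundNorm_combo_le x w v) hC
    linarith
  rcases (norm_nonneg w).eq_or_lt with h0 | h0
  · rw [← h0]
    exact mul_nonneg (mul_nonneg hC hx) (norm_nonneg _)
  · exact le_of_mul_le_mul_right h2 h0

/-- Under `M_1(Y) ≅ Y`, amplifying a map `f`, viewed as a `1 × 1` matrix of maps, amounts to
applying `f` entrywise. -/
theorem opNorm_flatten_matrixMap_one {Z : Type*} [AddCommGroup Z] [Module ℂ Z] (f : Z →ₗ[ℂ] ℂ)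
    {n : ℕ} (x : Matrix (Fin n) (Fin n) Z) :
    opNorm (flatten (x.map (matrixMap (Matrix.of fun _ _ : Fin 1 => f)))) =
      opNorm (x.map f) := by
  -- The flattened matrix is indexed by `Fin (n * 1)` rather than `Fin n`; it is `x.map f` reindexed
  -- along a bijection, which preserves matrix norms.
  exact scalarSpace.matNorm_submatrix
    (finProdFinEquiv.symm.trans (Equiv.prodUnique (Fin n) (Fin 1))) (x.map f)

/-- A contractive functional lies in the unit ball of the dual operator space. -/
theorem mem_dual_ball (S : FdOperatorSpace X) {f : Module.Dual ℂ X}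
    (h : ∀ x, ‖f x‖ ≤ S.groundNorm x) : f ∈ S.dual.ball := by
  refine S.cbNorm_le _ zero_le_one fun n x => ?_
  exact (opNorm_flatten_matrixMap_one f x).le.trans
    (S.opNorm_map_functional_le zero_le_one (fun y => by simpa using h y) n x)

/-- The canonical map `X → X**` is contractive. -/
theorem eval_mem_dual_dual_ball (S : FdOperatorSpace X) {x : X} (hx : x ∈ S.ball) :
    Module.Dual.eval ℂ X x ∈ S.dual.dual.ball := by
  refine S.dual.mem_dual_ball fun f => ?_
  -- Only the first amplification is needed: `‖f x‖ ≤ ‖f‖_cb ‖x‖`.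
  have h := S.matNorm_map_le (scalarSpace.matrixSpace 1)
    (matrixMap (Matrix.of fun _ _ : Fin 1 => f)) 1 (Matrix.of fun _ _ => x)
  have h1 : ‖f x‖ ≤ opNorm ((Matrix.of fun _ _ : Fin 1 => x).map f) := by
    have hd : (Matrix.of fun _ _ : Fin 1 => x).map f = Matrix.diagonal fun _ => f x := by
      ext i j
      simp [Subsingleton.elim i j]
    open scoped Matrix.Norms.L2Operator in
    rw [hd, opNorm_eq, Matrix.l2_opNorm_diagonal, pi_norm_const]
  rw [← opNorm_flatten_matrixMap_one] at h1
  exact h1.trans (h.trans (mul_le_of_le_one_right (S.dual.matNorm_nonneg _ _) hx))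

/-- A set is bipolar as soon as the functionals in its polar cut it out. -/
theorem isBipolar_of_forall (S : FdOperatorSpace X) {A : Set X} (hA : A ⊆ S.ball)
    (h : ∀ x, (∀ f ∈ S.polar A, f x = 1) → x ∈ A) : S.IsBipolar A :=
  -- The bound in `X**` is needed only for `A ⊆ d⁻¹[A°°]`; in the other direction it is discarded
  -- and only the equations `f x = 1` count.
  Set.Subset.antisymm
    (fun _ hx => ⟨S.eval_mem_dual_dual_ball (hA hx), fun _ hf => hf.2 _ hx⟩)
    fun x hx => h x hx.2

end FdOperatorSpace

/-! ### The norm of a C*-algebra as the norm on `M_1(A)` -/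

section canonical

variable {A : Type*} [CStarAlgebra A]

theorem norm_le_cstarMatNorm_one (x : A) : ‖x‖ ≤ cstarMatNorm 1 (Matrix.of fun _ _ => x) := by
  let _ : PartialOrder A := CStarAlgebra.spectralOrder A
  let _ : StarOrderedRing A := CStarAlgebra.spectralOrderedRing A
  exact CStarMatrix.norm_entry_le_norm
    (M := (CStarMatrix.ofMatrix (Matrix.of fun _ _ => x) : CStarMatrix (Fin 1) (Fin 1) A))
    (i := 0) (j := 0)

/-- The embedding of `A` as `1 × 1` matrices is a *-homomorphism, hence contractive. -/
theorem cstarMatNorm_one_le (x : A) : cstarMatNorm 1 (Matrix.of fun _ _ => x) ≤ ‖x‖ := by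
  let _ : PartialOrder A := CStarAlgebra.spectralOrder A
  let _ : StarOrderedRing A := CStarAlgebra.spectralOrderedRing A
  let φ : A →⋆ₙₐ[ℂ] CStarMatrix (Fin 1) (Fin 1) A :=
    { toFun := fun a => CStarMatrix.ofMatrix (Matrix.of fun _ _ => a)
      map_smul' := fun _ _ => rfl
      map_zero' := rfl
      map_add' := fun _ _ => rfl
      map_mul' := fun p q => by ext i j; simp [CStarMatrix.mul_apply]
      map_star' := fun p => by ext i j; simp [CStarMatrix.star_apply] }
  exact NonUnitalStarAlgHom.norm_apply_le φ x

theorem norm_le_one_of_mem_unitary {u : A} (hu : u ∈ unitary A) : ‖u‖ ≤ 1 := by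
  -- In the zero algebra `‖u‖ = 0`; otherwise a unitary has norm exactly `1`.
  nontriviality A
  exact (CStarRing.norm_of_mem_unitary hu).le

/-! ### States separate points -/

/-- A nonzero self-adjoint element of a C*-algebra is not annihilated by all states. -/
theorem exists_state_apply_ne_zero {a : A} (ha : IsSelfAdjoint a) (h0 : a ≠ 0) :
    ∃ φ : StrongDual ℂ A, ‖φ‖ ≤ 1 ∧ φ 1 = 1 ∧ φ a ≠ 0 := by
  have : Nontrivial A := ⟨a, 0, h0⟩
  have hpos : 0 < ‖a‖ := norm_pos_iff.2 h0
  -- One of `±‖a‖` lies in the spectrum of a self-adjoint `a`, and replacing `a` by `-a` does not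
  -- affect the conclusion.
  wlog hmem : ‖a‖ ∈ spectrum ℝ a generalizing a
  · have hneg : ‖-a‖ ∈ spectrum ℝ (-a) := by
      rcases CStarAlgebra.norm_or_neg_norm_mem_spectrum ha with h | h
      · exact absurd h hmem
      · rw [norm_neg, ← spectrum.neg_eq]
        simpa using h
    obtain ⟨φ, h1, h2, h3⟩ := this ha.neg (neg_ne_zero.2 h0) (by simpa using hpos) hneg
    exact ⟨φ, h1, h2, by simpa using h3⟩
  -- The shift makes the triangle inequality tight. If `φ` norms `b`, then `‖a‖ φ(1) + φ(a) = ‖b‖ ≥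
  -- 2‖a‖`, while each summand has real part at most `‖a‖`. So both real parts equal `‖a‖`: the
  -- first gives `Re φ(1) = 1`, the second `φ(a) ≠ 0`.
  set b : A := algebraMap ℝ A ‖a‖ + a with hb
  have hnorm : 2 * ‖a‖ ≤ ‖b‖ := by
    have h : ‖a‖ + ‖a‖ ∈ spectrum ℝ b := spectrum.add_mem_add_iff.2 hmem
    have := spectrum.norm_le_norm_of_mem h
    rw [Real.norm_of_nonneg (by positivity)] at this
    linarith
  obtain ⟨φ, hφ, hφb⟩ := exists_dual_vector ℂ b (by linarith)
  have h1 : ‖φ 1‖ ≤ 1 := (φ.le_opNorm 1).trans (by simp [hφ])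
  have h2 : ‖φ a‖ ≤ ‖a‖ := (φ.le_opNorm a).trans (by simp [hφ])
  have h3 : (‖a‖ : ℂ) * φ 1 + φ a = ‖b‖ := by
    refine Eq.trans ?_ hφb
    rw [hb, map_add, Algebra.algebraMap_eq_smul_one, ← Complex.coe_smul, map_smul, smul_eq_mul]
  have h4 : ‖a‖ * (φ 1).re + (φ a).re = ‖b‖ := by simpa using congrArg Complex.re h3
  have h5 := (Complex.re_le_norm _).trans h1
  have h6 := (Complex.re_le_norm _).trans h2
  have h7 : (φ 1).re = 1 := by
    refine le_antisymm h5 (le_of_mul_le_mul_left ?_ hpos)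
    linarith
  refine ⟨φ, hφ.le, ?_, fun h => ?_⟩
  -- A number in the closed unit disc with real part `1` is `1`.
  · have h8 : (φ 1).re ^ 2 + (φ 1).im ^ 2 ≤ 1 := by
      have := Complex.sq_norm (φ 1)
      rw [Complex.normSq_apply] at this
      nlinarith [norm_nonneg (φ 1)]
    refine Complex.ext h7 ?_
    rw [h7] at h8
    have : (φ 1).im ^ 2 = 0 := le_antisymm (by linarith) (sq_nonneg _)
    simpa using this
  · rw [h, Complex.zero_re, h7] at h4
    linarith

/-- A state is real on self-adjoint elements. -/
theorem state_apply_im_eq_zero {φ : StrongDual ℂ A} (hφ : ‖φ‖ ≤ 1) (h1 : φ 1 = 1) {a : A}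
    (ha : IsSelfAdjoint a) : (φ a).im = 0 := by
  -- Apply `φ` to `b = a + it`: the C*-identity gives `‖b‖² = ‖a² + t²‖ ≤ ‖a‖² + t²`, while `Im φ(b)
  -- = Im φ(a) + t`.
  have key : ∀ t : ℝ, ((φ a).im + t) ^ 2 ≤ ‖a‖ ^ 2 + t ^ 2 := fun t => by
    have : Nontrivial A := ⟨1, 0, fun h => by simp [h] at h1⟩
    set b : A := a + (t * Complex.I) • (1 : A) with hb
    have hbb : star b * b = a * a + ((t : ℂ) ^ 2) • (1 : A) := by
      rw [hb, star_add, star_smul, star_one, ha.star_eq]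
      simp only [add_mul, mul_add, smul_mul_assoc, mul_smul_comm, one_mul, mul_one,
        star_mul', Complex.star_def, Complex.conj_I, Complex.conj_ofReal]
      match_scalars
      · rfl
      · ring
      · linear_combination -(t : ℂ) ^ 2 * Complex.I_sq
    have h2 : ‖b‖ * ‖b‖ ≤ ‖a‖ ^ 2 + t ^ 2 := by
      rw [← CStarRing.norm_star_mul_self, hbb]
      refine (norm_add_le _ _).trans (add_le_add ?_ ?_)
      · rw [sq]; exact norm_mul_le _ _
      · rw [norm_smul]; simp
    have h3 : ‖φ b‖ ≤ ‖b‖ := φ.le_of_opNorm_le hφ b |>.trans_eq (one_mul _)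
    have h4 : (φ a).im + t = (φ b).im := by simp [hb, h1]
    rw [h4]
    have h5 := Complex.abs_im_le_norm (φ b)
    rw [← sq_abs]
    nlinarith [abs_nonneg (φ b).im, norm_nonneg (φ b)]
  by_contra h
  -- With `s = Im φ(a)`, `key` reads `s² + 2st ≤ ‖a‖²`; this `t` makes `2st = ‖a‖² + 1`, which is
  -- too large.
  have := key ((‖a‖ ^ 2 + 1) / (2 * (φ a).im))
  have h2 : 2 * (φ a).im * ((‖a‖ ^ 2 + 1) / (2 * (φ a).im)) = ‖a‖ ^ 2 + 1 :=
    mul_div_cancel₀ _ (by simpa using h)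
  nlinarith [sq_nonneg (φ a).im]

/-- The states of a C*-algebra separate points. -/
theorem eq_zero_of_forall_state {a : A}
    (h : ∀ φ : StrongDual ℂ A, ‖φ‖ ≤ 1 → φ 1 = 1 → φ a = 0) : a = 0 := by
  -- Since `φ` is real on self-adjoint elements, its values on the two parts of `a` are the real and
  -- imaginary parts of `φ a = 0`.
  have hparts : ∀ φ : StrongDual ℂ A, ‖φ‖ ≤ 1 → φ 1 = 1 →
      φ (realPart a : A) = 0 ∧ φ (imaginaryPart a : A) = 0 := fun φ hφ h1 => by
    have hr := state_apply_im_eq_zero hφ h1 (realPart a).2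
    have hi := state_apply_im_eq_zero hφ h1 (imaginaryPart a).2
    have h2 := h φ hφ h1
    rw [← realPart_add_I_smul_imaginaryPart a, map_add, map_smul, smul_eq_mul] at h2
    have h3 := congrArg Complex.re h2
    have h4 := congrArg Complex.im h2
    simp [hr, hi] at h3 h4
    exact ⟨Complex.ext h3 hr, Complex.ext h4 hi⟩
  have hr : (realPart a : A) = 0 := by
    by_contra h0
    obtain ⟨φ, hφ, h1, h2⟩ := exists_state_apply_ne_zero (realPart a).2 h0
    exact h2 (hparts φ hφ h1).1
  have hi : (imaginaryPart a : A) = 0 := by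
    by_contra h0
    obtain ⟨φ, hφ, h1, h2⟩ := exists_state_apply_ne_zero (imaginaryPart a).2 h0
    exact h2 (hparts φ hφ h1).2
  rw [← realPart_add_I_smul_imaginaryPart a, hr, hi, smul_zero, add_zero]

/-! ### The polar of a unitary -/

/-- Translating a state by a unitary `u` gives an element of the polar of `{u}`. -/
theorem state_comp_mul_star_mem_polar [FiniteDimensional ℂ A] {u : A} (hu : u ∈ unitary A)
    {φ : StrongDual ℂ A} (hφ : ‖φ‖ ≤ 1) (h1 : φ 1 = 1) :
    φ.toLinearMap ∘ₗ LinearMap.mulLeft ℂ (star u) ∈ (canonical A).polar {u} := by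
  refine ⟨(canonical A).mem_dual_ball fun x => ?_, ?_⟩
  · calc ‖φ (star u * x)‖ ≤ 1 * ‖star u * x‖ := φ.le_of_opNorm_le hφ _
      _ ≤ ‖star u‖ * ‖x‖ := by rw [one_mul]; exact norm_mul_le _ _
      _ ≤ ‖x‖ := mul_le_of_le_one_left (norm_nonneg _)
          (norm_le_one_of_mem_unitary (Unitary.star_mem hu))
      _ ≤ _ := norm_le_cstarMatNorm_one x
  · rintro _ rfl
    simp [Unitary.star_mul_self_of_mem hu, h1]

end canonical

end OpSpace

theorem mainTheorem10 {M : Type*} [CStarAlgebra M] [FiniteDimensional ℂ M] (u : M)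
    (hu : u ∈ unitary M) :
    (OpSpace.canonical M).IsQObject {u} := by
  have hball : {u} ⊆ (OpSpace.canonical M).ball := by
    rintro _ rfl
    exact (OpSpace.cstarMatNorm_one_le _).trans (OpSpace.norm_le_one_of_mem_unitary hu)
  refine ⟨hball, OpSpace.FdOperatorSpace.isBipolar_of_forall _ hball fun x hx => ?_⟩
  -- The translated states already cut out `u`: membership of `x` gives `φ (star u * x) = 1 = φ 1`
  -- for every state `φ`.
  have h : star u * x - 1 = 0 := OpSpace.eq_zero_of_forall_state fun φ hφ h1 => by
    have := hx _ (OpSpace.state_comp_mul_star_mem_polar hu hφ h1)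
    rw [map_sub, h1, sub_eq_zero]
    exact this
  calc x = u * (star u * x) := by rw [← mul_assoc, Unitary.mul_star_self_of_mem hu, one_mul]
    _ = u := by rw [sub_eq_zero.1 h, mul_one]
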